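/- Let $\mathcal X,\mathcal Y$ be real Hilbert spaces, let $f\colon\mathcal X\to\mathbb R$ be convex and continuously differentiable with $\ell$-Lipschitz continuous gradient for some $\ell\ge 0$, let $A\colon\mathcal X\to\mathcal Y$ be a continuous linear operator and $b\in\mathcal Y$. Put $$\mathcal L(x,\lambda)=f(x)+\langle\lambda,Ax-b\rangle,\qquad \mathcal L_\beta(x,\lambda)=\mathcal L(x,\lambda)+\tfrac{\beta}{2}\|Ax-b\|^2 ,$$ and let $\mathbb S$ be the set of primal-dual optimal solutions of the problem $\min\{f(x): Ax=b\}$, i.e. of the pairs $(x_*,\lambda_*)\in\mathcal X\times\mathcal Y$ with $\mathcal L(x_*,\lambda)\le\mathcal L(x_*,\lambda_*)\le\mathcal L(x,\lambda_*)$ for all $(x,\lambda)\in\mathcal X\times\mathcal Y$. Assume that $\mathbb S\neq\emptyset$, and let $t_0>0$, $\alpha>3$, $\beta\ge 0$ and $\frac{1}{\alpha-1}<\theta<\frac12$. Let $(x,\lambda)\colon[t_0,+\infty)\to\mathcal X\times\mathcal Y$ be a twice continuously differentiable solution (with arbitrary initial data $x(t_0)=x_0$, $\lambda(t_0)=\lambda_0$,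 $\dot x(t_0)=\dot x_0$, $\dot\lambda(t_0)=\dot\lambda_0$) of $$\begin{cases}\ddot x(t)+\frac{\alpha}{t}\dot x(t)+\nabla_x\mathcal L_\beta\bigl(x(t),\lambda(t)+\theta t\dot\lambda(t)\bigr)=0,\\[2pt] \ddot\lambda(t)+\frac{\alpha}{t}\dot\lambda(t)-\nabla_\lambda\mathcal L_\beta\bigl(x(t)+\theta t\dot x(t),\lambda(t)\bigr)=0,\end{cases}\qquad t\ge t_0 .$$ Then there is $(\bar x,\bar\lambda)\in\mathbb S$ such that $(x(t),\lambda(t))$ converges weakly to $(\bar x,\bar\lambda)$ in the Hilbert space $\mathcal X\times\mathcal Y$ as $t\to+\infty$. -/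

import Mathlib

open Filter Topology Set
open scoped NNReal

noncomputable section

namespace PDAVD

variable {X Y : Type*} [NormedAddCommGroup X] [InnerProductSpace ℝ X]
  [NormedAddCommGroup Y] [InnerProductSpace ℝ Y]

/-- The Lagrangian `L(x, μ) = f x + ⟪μ, A x - b⟫` of the problem `min f x` subject to `A x = b`. -/
def lagrangian (f : X → ℝ) (A : X →L[ℝ] Y) (b : Y) (x : X) (μ : Y) : ℝ :=
  f x + inner ℝ μ (A x - b)

/-- The augmented Lagrangian `L_β(x, μ) = L(x, μ) + (β / 2) ‖A x - b‖²`. -/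
def augLagrangian (f : X → ℝ) (A : X →L[ℝ] Y) (b : Y) (β : ℝ) (x : X) (μ : Y) : ℝ :=
  lagrangian f A b x μ + β / 2 * ‖A x - b‖ ^ 2

/-- The set of primal-dual optimal solutions, that is, of saddle points of the Lagrangian. -/
def primalDualSolutions (f : X → ℝ) (A : X →L[ℝ] Y) (b : Y) : Set (X × Y) :=
  {p | ∀ (x : X) (μ : Y),
    lagrangian f A b p.1 μ ≤ lagrangian f A b p.1 p.2 ∧
      lagrangian f A b p.1 p.2 ≤ lagrangian f A b x p.2}

/-- The derivative along `[t₀, ∞)` of a curve defined on that half-line (one-sided at `t₀`).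
Values of the curve before `t₀` play no role. -/
def velocity {E : Type*} [NormedAddCommGroup E] [NormedSpace ℝ E] (t₀ : ℝ) (x : ℝ → E) : ℝ → E :=
  derivWithin x (Ici t₀)

/-- The second derivative along `[t₀, ∞)`. -/
def acceleration {E : Type*} [NormedAddCommGroup E] [NormedSpace ℝ E] (t₀ : ℝ) (x : ℝ → E) :
    ℝ → E :=
  velocity t₀ (velocity t₀ x)

/-- `(x, lam) : [t₀, ∞) → X × Y` is a global twice continuously differentiable solution of the
primal-dual dynamical system with asymptotically vanishing damping, with initial position
`(x₀, lam₀)` and initial velocity `(v₀, w₀)`. -/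
structure IsSolution [CompleteSpace X] [CompleteSpace Y]
    (f : X → ℝ) (A : X →L[ℝ] Y) (b : Y) (α β θ t₀ : ℝ)
    (x₀ v₀ : X) (lam₀ w₀ : Y) (x : ℝ → X) (lam : ℝ → Y) : Prop where
  contDiffOn_primal : ContDiffOn ℝ 2 x (Ici t₀)
  contDiffOn_dual : ContDiffOn ℝ 2 lam (Ici t₀)
  primal_eq : ∀ t, t₀ ≤ t →
    acceleration t₀ x t + (α / t) • velocity t₀ x t
      + gradient (fun z => augLagrangian f A b β z (lam t + (θ * t) • velocity t₀ lam t)) (x t) = 0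
  dual_eq : ∀ t, t₀ ≤ t →
    acceleration t₀ lam t + (α / t) • velocity t₀ lam t
      - gradient (fun μ => augLagrangian f A b β (x t + (θ * t) • velocity t₀ x t) μ) (lam t) = 0
  primal_init : x t₀ = x₀
  dual_init : lam t₀ = lam₀
  primal_velocity_init : velocity t₀ x t₀ = v₀
  dual_velocity_init : velocity t₀ lam t₀ = w₀

end PDAVD

end

/-!
# Weak convergence of a primal-dual system with vanishing damping

Fix a saddle point `p = (x*, μ*)`. Write `z = (x, lam)`, `G = L_β(x, μ*) - f(x*)` for the gap,
`W = G + ‖z'‖² / 2`, `φ = ‖z - p‖² / 2` and `ξ = θ (α - 1) - 1 > 0`. The energy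
`E = θ² t² G + ‖z - p + θ t z'‖² / 2 + ξ φ` satisfies `E' ≤ -c θ t W` with some `c > 0`, since the
extrapolation terms of the system make the coupling terms cancel (`hasDerivAt_energy`,
`energy_deriv_le`). So `z` and `t z'` are bounded, `G = O(1 / t²)`, and a primitive `R` of `θ t W`
converges.

Weak convergence follows from Opial's lemma (`exists_weak_limit_of_opial`), which has two
hypotheses.

* The distance to each saddle point converges (`exists_tendsto_anchor`). The energy equals
  `θ (t (φ + R)' + (α - 1) φ)`, and both `E` and `R` converge. Hence `φ + R` solves an Euler equation
  `t u' + (α - 1) u = r` with convergent right-hand side, which forces `u` to converge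
  (`tendsto_of_euler`).
* Weak limit points are saddle points (`mem_primalDualSolutions_of_weak_limit`). Multiplied by `t`
  and paired with a fixed vector, each of the two equations can be integrated. The result is an
  Euler equation for a primitive of `t ⟪A x - b, w⟫`, respectively of `t ⟪lam - μ*, A w⟫`, whose
  right-hand side is `O(t)`, so that `A x - b` and `A* (lam - μ*)` tend weakly to `0`
  (`tendsto_inner_residual`, `tendsto_inner_multiplier`). For the second one the Lipschitz
  continuity of the gradient is needed: cocoercivity and `G = O(1 / t²)` give
  `‖∇f(x) - ∇f(x*)‖ = O(1 / t)`. A weak limit `(x̄, μ̄)` then satisfies `A x̄ = b`,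
  `A* μ̄ = A* μ*` and, by convexity, `G(x̄) ≤ 0`, which makes it a saddle point.
-/

namespace PDAVD

/-! ### Scalar differential inequalities of Euler type -/

/-- `t ^ (a - 1)` is an integrating factor: `(t ^ a * u)' = t ^ (a - 1) * (t u' + a u)`. -/
theorem rpow_mul_le_of_euler {u u' : ℝ → ℝ} {a T : ℝ} (hT : 0 < T)
    (hu : ∀ t, T ≤ t → HasDerivAt u (u' t) t) (h : ∀ t, T ≤ t → t * u' t + a * u t ≤ 0)
    {t : ℝ} (ht : T ≤ t) : t ^ a * u t ≤ T ^ a * u T := by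
  have hd : ∀ s, T ≤ s →
      HasDerivAt (fun s => s ^ a * u s) (a * s ^ (a - 1) * u s + s ^ a * u' s) s := fun s hs =>
    (Real.hasDerivAt_rpow_const (Or.inl (hT.trans_le hs).ne')).mul (hu s hs)
  have hanti : AntitoneOn (fun s => s ^ a * u s) (Ici T) := by
    refine antitoneOn_of_hasDerivWithinAt_nonpos (convex_Ici T)
      (fun s hs => (hd s hs).continuousAt.continuousWithinAt)
      (fun s hs => (hd s (interior_subset hs)).hasDerivWithinAt) fun s hs => ?_
    have hs' : T ≤ s := interior_subset hs
    have hs0 : 0 < s := hT.trans_le hs'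
    have e : a * s ^ (a - 1) * u s + s ^ a * u' s = s ^ (a - 1) * (s * u' s + a * u s) := by
      have : s ^ a = s ^ (a - 1) * s := by
        rw [← Real.rpow_add_one hs0.ne']; congr 1; ring
      rw [this]; ring
    rw [e]
    exact mul_nonpos_of_nonneg_of_nonpos (by positivity) (h s hs')
  exact hanti self_mem_Ici ht ht

theorem nonpos_of_euler {u u' : ℝ → ℝ} {a T : ℝ} (hT : 0 < T)
    (hu : ∀ t, T ≤ t → HasDerivAt u (u' t) t) (h : ∀ t, T ≤ t → t * u' t + a * u t ≤ 0)
    (h0 : u T ≤ 0) {t : ℝ} (ht : T ≤ t) : u t ≤ 0 := by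
  have h1 := rpow_mul_le_of_euler hT hu h ht
  have h2 : T ^ a * u T ≤ 0 := mul_nonpos_of_nonneg_of_nonpos (by positivity) h0
  have h3 : 0 < t ^ a := Real.rpow_pos_of_pos (hT.trans_le ht) a
  by_contra! h4
  nlinarith [mul_pos h3 h4]

theorem eventually_lt_of_euler {u u' : ℝ → ℝ} {a L T ε : ℝ} (hT : 0 < T) (ha : 0 < a)
    (hε : 0 < ε) (hu : ∀ t, T ≤ t → HasDerivAt u (u' t) t)
    (h : Tendsto (fun t => t * u' t + a * u t) atTop (𝓝 L)) :
    ∀ᶠ t in atTop, u t < L / a + ε := by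
  obtain ⟨S, hS⟩ := eventually_atTop.1
    (h.eventually (gt_mem_nhds (show L < L + a * (ε / 2) by nlinarith [mul_pos ha hε])))
  have hS' : 0 < max S T := hT.trans_le (le_max_right _ _)
  have key : ∀ t, max S T ≤ t →
      t ^ a * (u t - (L / a + ε / 2)) ≤ (max S T) ^ a * (u (max S T) - (L / a + ε / 2)) := by
    intro t ht
    refine rpow_mul_le_of_euler (u := fun t => u t - (L / a + ε / 2)) (u' := u') hS'
      (fun s hs => (hu s ((le_max_right _ _).trans hs)).sub_const _) (fun s hs => ?_) ht
    have h1 := hS s ((le_max_left _ _).trans hs)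
    have h2 : a * (u s - (L / a + ε / 2)) = a * u s - L - a * (ε / 2) := by
      field_simp
      ring
    rw [h2]; linarith
  set C := (max S T) ^ a * (u (max S T) - (L / a + ε / 2))
  filter_upwards [eventually_ge_atTop (max S T),
    (tendsto_rpow_atTop ha).eventually_gt_atTop (C / (ε / 2))] with t ht h1
  have h2 := key t ht
  have h3 : 0 < t ^ a := Real.rpow_pos_of_pos (hS'.trans_le ht) a
  rw [div_lt_iff₀ (by positivity)] at h1
  have h4 : u t - (L / a + ε / 2) < ε / 2 := lt_of_mul_lt_mul_left (h2.trans_lt h1) h3.le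
  linarith

/-- Euler's first order equation `t u' + a u = r` with `a > 0` forgets its initial value: `u`
converges as soon as `r` does. -/
theorem tendsto_of_euler {u u' : ℝ → ℝ} {a L T : ℝ} (hT : 0 < T) (ha : 0 < a)
    (hu : ∀ t, T ≤ t → HasDerivAt u (u' t) t)
    (h : Tendsto (fun t => t * u' t + a * u t) atTop (𝓝 L)) :
    Tendsto u atTop (𝓝 (L / a)) := by
  refine (nhds_basis_abs_sub_lt (L / a)).tendsto_right_iff.2 fun ε hε => ?_
  have hneg : Tendsto (fun t => t * (-u' t) + a * (-u t)) atTop (𝓝 (-L)) := by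
    refine h.neg.congr fun t => ?_
    ring
  filter_upwards [eventually_lt_of_euler hT ha hε hu h,
    eventually_lt_of_euler (u := fun t => -u t) (u' := fun t => -u' t) hT ha hε
      (fun t ht => (hu t ht).neg) hneg] with t h1 h2
  rw [neg_div] at h2
  rw [abs_lt]
  constructor <;> linarith

/-- Comparison of `u` and `-u` with the linear function `M * t`. -/
theorem abs_le_mul_of_euler {u u' : ℝ → ℝ} {a K T : ℝ} (hT : 0 < T) (ha : 0 ≤ a) (hK : 0 ≤ K)
    (hu : ∀ t, T ≤ t → HasDerivAt u (u' t) t)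
    (h : ∀ t, T ≤ t → |t * u' t + a * u t| ≤ K * t) :
    ∃ M, 0 ≤ M ∧ ∀ t, T ≤ t → |u t| ≤ M * t := by
  set M := K + |u T| / T with hM
  have hM0 : 0 ≤ M := by positivity
  have hMT : |u T| ≤ M * T := by
    rw [hM, add_mul, div_mul_cancel₀ _ hT.ne']
    nlinarith
  have hKM : K ≤ M := by rw [hM]; linarith [show 0 ≤ |u T| / T by positivity]
  refine ⟨M, hM0, fun t ht => abs_le.2 ?_⟩
  have lin : ∀ s, HasDerivAt (fun s : ℝ => M * s) M s := fun s => by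
    simpa using (hasDerivAt_id s).const_mul M
  have bd : ∀ s, T ≤ s → K * s ≤ s * M + a * (M * s) := fun s hs => by
    have hs0 : 0 < s := hT.trans_le hs
    nlinarith [mul_nonneg ha (mul_nonneg hM0 hs0.le), mul_le_mul_of_nonneg_right hKM hs0.le]
  have h1 := nonpos_of_euler (u := fun s => u s - M * s) (a := a) hT
    (fun s hs => (hu s hs).sub (lin s))
    (fun s hs => by linarith [(abs_le.1 (h s hs)).2, bd s hs])
    (by linarith [(abs_le.1 hMT).2]) ht
  have h2 := nonpos_of_euler (u := fun s => -u s - M * s) (a := a) hT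
    (fun s hs => (hu s hs).neg.sub (lin s))
    (fun s hs => by linarith [(abs_le.1 (h s hs)).1, bd s hs])
    (by linarith [(abs_le.1 hMT).1]) ht
  constructor <;> linarith

theorem tendsto_zero_of_abs_sq_mul_le {q : ℝ → ℝ} {K T : ℝ}
    (h : ∀ t, T ≤ t → |t ^ 2 * q t| ≤ K * t) : Tendsto q atTop (𝓝 0) := by
  have hlim : Tendsto (fun t : ℝ => K * t⁻¹) atTop (𝓝 0) := by
    simpa using tendsto_inv_atTop_zero.const_mul K
  refine squeeze_zero_norm' ?_ hlim
  filter_upwards [eventually_ge_atTop T, eventually_gt_atTop 0] with t ht ht0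
  have h1 := h t ht
  rw [abs_mul, abs_of_pos (by positivity : 0 < t ^ 2)] at h1
  rw [Real.norm_eq_abs, ← div_eq_mul_inv, le_div_iff₀ ht0]
  have : t * (|q t| * t) ≤ t * K := by linarith [h1, (by ring : t * (|q t| * t) = t ^ 2 * |q t|)]
  exact le_of_mul_le_mul_left this ht0

/-- If `Q' = t q` and the combination `θ t² q + c Q`, which equals `θ t Q' + c Q`, grows at most
linearly, then so does `Q`, and `q` tends to `0` like `1 / t`. -/
theorem tendsto_zero_of_combination {q Q : ℝ → ℝ} {c θ K T : ℝ} (hT : 0 < T) (hc : 0 ≤ c)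
    (hθ : 0 < θ) (hK : 0 ≤ K) (hQ : ∀ t, T ≤ t → HasDerivAt Q (t * q t) t)
    (h : ∀ t, T ≤ t → |θ * t ^ 2 * q t + c * Q t| ≤ K * t) :
    (∃ M, 0 ≤ M ∧ ∀ t, T ≤ t → |Q t| ≤ M * t) ∧ Tendsto q atTop (𝓝 0) := by
  obtain ⟨M, hM0, hM⟩ := abs_le_mul_of_euler (a := c / θ) (K := K / θ) hT (by positivity)
    (by positivity) hQ fun t ht => by
      have e : t * (t * q t) + c / θ * Q t = (θ * t ^ 2 * q t + c * Q t) / θ := by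
        field_simp
      rw [e, abs_div, abs_of_pos hθ, div_mul_eq_mul_div]
      exact div_le_div_of_nonneg_right (h t ht) hθ.le
  refine ⟨⟨M, hM0, hM⟩, tendsto_zero_of_abs_sq_mul_le (K := (K + c * M) / θ) (T := T)
    fun t ht => ?_⟩
  have h1 := abs_le.1 (h t ht)
  have h2 := abs_le.1 (hM t ht)
  have e : t ^ 2 * q t = (θ * t ^ 2 * q t) / θ := by field_simp
  rw [e, abs_div, abs_of_pos hθ, div_mul_eq_mul_div]
  refine div_le_div_of_nonneg_right (abs_le.2 ⟨?_, ?_⟩) hθ.le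
  · nlinarith [mul_le_mul_of_nonneg_left h2.2 hc]
  · nlinarith [mul_le_mul_of_nonneg_left h2.1 hc]

/-! ### Primitives on a half-line -/

theorem exists_primitive {g : ℝ → ℝ} {t₀ T : ℝ} (hT : t₀ < T) (hg : ContinuousOn g (Ioi t₀)) :
    ∃ F : ℝ → ℝ, ∀ t, T ≤ t → HasDerivAt F (g t) t := by
  refine ⟨fun t => ∫ s in T..t, g s, fun t ht => ?_⟩
  have ht' : t₀ < t := hT.trans_le ht
  refine intervalIntegral.integral_hasDerivAt_right ?_
    (hg.stronglyMeasurableAtFilter isOpen_Ioi t ht') (hg.continuousAt (Ioi_mem_nhds ht'))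
  refine (hg.mono fun s hs => ?_).intervalIntegrable
  rw [uIcc_of_le ht] at hs
  exact hT.trans_le hs.1

theorem monotoneOn_of_hasDerivAt_nonneg {u u' : ℝ → ℝ} {T : ℝ}
    (hu : ∀ t, T ≤ t → HasDerivAt u (u' t) t) (h : ∀ t, T ≤ t → 0 ≤ u' t) :
    MonotoneOn u (Ici T) :=
  monotoneOn_of_hasDerivWithinAt_nonneg (convex_Ici T)
    (fun s hs => (hu s hs).continuousAt.continuousWithinAt)
    (fun s hs => (hu s (interior_subset hs)).hasDerivWithinAt) fun s hs => h s (interior_subset hs)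

theorem exists_tendsto_of_monotoneOn_Ici {u : ℝ → ℝ} {T M : ℝ} (h : MonotoneOn u (Ici T))
    (hM : ∀ t, T ≤ t → u t ≤ M) : ∃ l, Tendsto u atTop (𝓝 l) := by
  have hmono : Monotone fun t => u (max t T) := fun s t hst =>
    h (mem_Ici.2 (le_max_right _ _)) (mem_Ici.2 (le_max_right _ _)) (max_le_max_right T hst)
  refine ⟨_, (tendsto_atTop_ciSup hmono ⟨M, ?_⟩).congr' ?_⟩
  · rintro _ ⟨t, rfl⟩
    exact hM _ (le_max_right _ _)
  · filter_upwards [eventually_ge_atTop T] with t ht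
    rw [max_eq_left ht]

theorem eq_of_hasDerivAt_zero {u : ℝ → ℝ} {T : ℝ} (hu : ∀ t, T ≤ t → HasDerivAt u 0 t)
    {t : ℝ} (ht : T ≤ t) : u t = u T := by
  have h1 := monotoneOn_of_hasDerivAt_nonneg hu (fun _ _ => le_rfl) self_mem_Ici ht ht
  have h2 := monotoneOn_of_hasDerivAt_nonneg (u := fun s => -u s) (u' := fun _ => 0)
    (fun s hs => (hu s hs).neg.congr_deriv neg_zero) (fun _ _ => le_rfl) self_mem_Ici ht ht
  simp only at h2
  linarith

theorem abs_le_mul_of_abs_deriv_le {u u' : ℝ → ℝ} {K T : ℝ} (hT : 0 < T) (hK : 0 ≤ K)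
    (hu : ∀ t, T ≤ t → HasDerivAt u (u' t) t) (h : ∀ t, T ≤ t → |u' t| ≤ K) :
    ∃ M, 0 ≤ M ∧ ∀ t, T ≤ t → |u t| ≤ M * t :=
  abs_le_mul_of_euler (a := 0) hT le_rfl hK hu fun t ht => by
    have ht0 : 0 < t := hT.trans_le ht
    rw [zero_mul, add_zero, abs_mul, abs_of_pos ht0, mul_comm]
    exact mul_le_mul_of_nonneg_right (h t ht) ht0.le

/-! ### Weak convergence in Hilbert spaces -/

section Opial

variable {H : Type*} [NormedAddCommGroup H] [InnerProductSpace ℝ H]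

theorem tendsto_toWeakSpace_iff [CompleteSpace H] {ι : Type*} {F : Filter ι} {z : ι → H} {p : H} :
    Tendsto (fun i => toWeakSpace ℝ H (z i)) F (𝓝 (toWeakSpace ℝ H p)) ↔
      ∀ w, Tendsto (fun i => inner ℝ (z i) w) F (𝓝 (inner ℝ p w)) := by
  have hinj : Function.Injective (topDualPairing ℝ H).flip := by
    intro u v huv
    refine ext_inner_left ℝ fun w => ?_
    exact congrArg (fun B => B (InnerProductSpace.toDual ℝ H w)) huv
  rw [show (Tendsto (fun i => toWeakSpace ℝ H (z i)) F (𝓝 (toWeakSpace ℝ H p)) ↔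
      ∀ φ : StrongDual ℝ H, Tendsto (fun i => φ (z i)) F (𝓝 (φ p))) from
    WeakBilin.tendsto_iff_forall_eval_tendsto _ hinj]
  refine ⟨fun h w => ?_, fun h φ => ?_⟩
  · simpa [real_inner_comm w] using h (InnerProductSpace.toDual ℝ H w)
  · have := h ((InnerProductSpace.toDual ℝ H).symm φ)
    simpa [real_inner_comm ((InnerProductSpace.toDual ℝ H).symm φ)] using this

/-- Weak compactness of balls, in the form needed here: a bounded family converges weakly along
every ultrafilter. The limit functional `w ↦ lim ⟪z i, w⟫` is represented by the
Fréchet–Riesz theorem. -/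
theorem exists_weak_limit_of_bounded [CompleteSpace H] {ι : Type*} (U : Ultrafilter ι) {z : ι → H}
    {M : ℝ} (hz : ∀ᶠ i in (U : Filter ι), ‖z i‖ ≤ M) :
    ∃ p, ∀ w, Tendsto (fun i => inner ℝ (z i) w) U (𝓝 (inner ℝ p w)) := by
  have hlim : ∀ w, ∃ l ∈ Icc (-(M * ‖w‖)) (M * ‖w‖),
      Tendsto (fun i => inner ℝ (z i) w) U (𝓝 l) := by
    intro w
    have hmem : ∀ᶠ i in (U : Filter ι), inner ℝ (z i) w ∈ Icc (-(M * ‖w‖)) (M * ‖w‖) := by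
      filter_upwards [hz] with i hi
      exact abs_le.1 ((abs_real_inner_le_norm _ _).trans
        (mul_le_mul_of_nonneg_right hi (norm_nonneg w)))
    exact isCompact_Icc.ultrafilter_le_nhds (U.map fun i => inner ℝ (z i) w)
      (le_principal_iff.2 hmem)
  choose φ hφ hφlim using hlim
  let Φ : H →ₗ[ℝ] ℝ :=
    { toFun := φ
      map_add' := fun v w => tendsto_nhds_unique (hφlim (v + w)) (by
        simpa only [inner_add_right] using (hφlim v).add (hφlim w))
      map_smul' := fun c w => tendsto_nhds_unique (hφlim (c • w)) (by
        simpa only [inner_smul_right, smul_eq_mul, RingHom.id_apply] using (hφlim w).const_mul c) }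
  refine ⟨(InnerProductSpace.toDual ℝ H).symm
    (Φ.mkContinuous M fun w => by simpa [Φ] using abs_le.2 (hφ w)), fun w => ?_⟩
  rw [InnerProductSpace.toDual_symm_apply]
  exact hφlim w

/-- Uniqueness in Opial's lemma: `‖z - p‖² - ‖z - q‖²` is affine in `⟪z, p - q⟫`, which therefore
has a limit along `F`; this limit is both `⟪p, p - q⟫` and `⟪q, p - q⟫`. -/
theorem eq_of_weak_limits {ι : Type*} {F : Filter ι} {U V : Filter ι} [U.NeBot] [V.NeBot]
    (hU : U ≤ F) (hV : V ≤ F) {z : ι → H} {p q : H}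
    (hp : ∃ l, Tendsto (fun i => ‖z i - p‖ ^ 2) F (𝓝 l))
    (hq : ∃ l, Tendsto (fun i => ‖z i - q‖ ^ 2) F (𝓝 l))
    (hpU : ∀ w, Tendsto (fun i => inner ℝ (z i) w) U (𝓝 (inner ℝ p w)))
    (hqV : ∀ w, Tendsto (fun i => inner ℝ (z i) w) V (𝓝 (inner ℝ q w))) : p = q := by
  obtain ⟨l, hl⟩ := hp
  obtain ⟨m, hm⟩ := hq
  have key : Tendsto (fun i => inner ℝ (z i) (p - q)) F
      (𝓝 (-(l - m - (‖p‖ ^ 2 - ‖q‖ ^ 2)) / 2)) := by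
    refine (((hl.sub hm).sub_const _).neg.div_const 2).congr fun i => ?_
    rw [norm_sub_sq_real, norm_sub_sq_real, inner_sub_right]
    ring
  have h1 := tendsto_nhds_unique (hpU (p - q)) (key.mono_left hU)
  have h2 := tendsto_nhds_unique (hqV (p - q)) (key.mono_left hV)
  rw [← sub_eq_zero, ← inner_self_eq_zero (𝕜 := ℝ), inner_sub_left, h1, h2, sub_self]

/-- Opial's lemma: if the distance to each point of `S` converges and all weak limits along
ultrafilters lie in `S`, then the whole family converges weakly to a point of `S`. -/
theorem exists_weak_limit_of_opial [CompleteSpace H] {ι : Type*} {F : Filter ι} [F.NeBot]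
    {z : ι → H} {S : Set H} {M : ℝ} (hz : ∀ᶠ i in F, ‖z i‖ ≤ M)
    (hlim : ∀ p ∈ S, ∃ l, Tendsto (fun i => ‖z i - p‖ ^ 2) F (𝓝 l))
    (hcluster : ∀ U : Ultrafilter ι, (U : Filter ι) ≤ F → ∀ p,
      (∀ w, Tendsto (fun i => inner ℝ (z i) w) U (𝓝 (inner ℝ p w))) → p ∈ S) :
    ∃ p ∈ S, ∀ w, Tendsto (fun i => inner ℝ (z i) w) F (𝓝 (inner ℝ p w)) := by
  have hex : ∀ U : Ultrafilter ι, (U : Filter ι) ≤ F →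
      ∃ p ∈ S, ∀ w, Tendsto (fun i => inner ℝ (z i) w) U (𝓝 (inner ℝ p w)) := fun U hU => by
    obtain ⟨p, hp⟩ := exists_weak_limit_of_bounded U (hz.filter_mono hU)
    exact ⟨p, hcluster U hU p hp, hp⟩
  obtain ⟨p, hpS, hp⟩ := hex (Ultrafilter.of F) (Ultrafilter.of_le F)
  refine ⟨p, hpS, fun w => (tendsto_iff_ultrafilter _ _ _).2 fun U hU => ?_⟩
  obtain ⟨q, hqS, hq⟩ := hex U hU
  have hpq := eq_of_weak_limits (Ultrafilter.of_le F) hU (hlim p hpS) (hlim q hqS) hp hq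
  exact hpq ▸ hq w

end Opial

/-! ### Convex functions with Lipschitz continuous gradient -/

section Convex

variable {H : Type*} [NormedAddCommGroup H] [InnerProductSpace ℝ H]

theorem add_inner_le_of_convexOn [CompleteSpace H] {f : H → ℝ} (hf : ConvexOn ℝ univ f)
    (hd : Differentiable ℝ f) (x y : H) : f x + inner ℝ (gradient f x) (y - x) ≤ f y := by
  have hc : ConvexOn ℝ univ (f ∘ AffineMap.lineMap (k := ℝ) x y) := hf.comp_affineMap _
  have hfx : HasFDerivAt f (fderiv ℝ f x) (AffineMap.lineMap (k := ℝ) x y 0) := by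
    simpa using (hd x).hasFDerivAt
  have hder : HasDerivAt (f ∘ AffineMap.lineMap (k := ℝ) x y) (fderiv ℝ f x (y - x)) 0 :=
    hfx.comp_hasDerivAt (0 : ℝ) AffineMap.hasDerivAt_lineMap
  have := hc.le_slope_of_hasDerivAt (mem_univ 0) (mem_univ 1) one_pos hder
  rw [slope_def_field] at this
  simp only [Function.comp_apply, AffineMap.lineMap_apply_one, AffineMap.lineMap_apply_zero,
    sub_zero, div_one] at this
  rw [inner_gradient_left]
  linarith

/-- Cocoercivity of the gradient. The squared distance of two gradients is bounded by a multiple of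
the Bregman distance: apply the tangent inequality at `x - s • d` and at `y`, where `d` is the
difference of the gradients and the step `s` is short enough that the gradient at `x - s • d` is
still close to the one at `x`. -/
theorem norm_gradient_sub_sq_le [CompleteSpace H] {f : H → ℝ} (hf : ConvexOn ℝ univ f)
    (hd : Differentiable ℝ f) {ℓ : ℝ≥0} (hlip : LipschitzWith ℓ (gradient f)) (x y : H) :
    ‖gradient f x - gradient f y‖ ^ 2 ≤
      4 * (ℓ + 1) * (f x - f y - inner ℝ (gradient f y) (x - y)) := by
  set d := gradient f x - gradient f y with hd_def
  have hℓ : (0 : ℝ) ≤ ℓ := ℓ.2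
  set s : ℝ := 1 / (2 * (ℓ + 1)) with hs
  have hs0 : 0 < s := by positivity
  have h1 := add_inner_le_of_convexOn hf hd (x - s • d) x
  have h2 := add_inner_le_of_convexOn hf hd y (x - s • d)
  have h3 : ‖gradient f (x - s • d) - gradient f x‖ ≤ ℓ * (s * ‖d‖) := by
    have := hlip.dist_le_mul (x - s • d) x
    rwa [dist_eq_norm, dist_eq_norm, sub_sub_cancel_left, norm_neg, norm_smul,
      Real.norm_of_nonneg hs0.le] at this
  have h4 : -(ℓ * s * ‖d‖ ^ 2) ≤ inner ℝ (gradient f (x - s • d) - gradient f x) d := by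
    have := (abs_le.1 (abs_real_inner_le_norm (gradient f (x - s • d) - gradient f x) d)).1
    nlinarith [mul_le_mul_of_nonneg_right h3 (norm_nonneg d)]
  have h5 : inner ℝ (gradient f x) d - inner ℝ (gradient f y) d = ‖d‖ ^ 2 := by
    rw [← inner_sub_left, ← hd_def, real_inner_self_eq_norm_sq]
  rw [sub_sub_cancel, inner_smul_right] at h1
  rw [show x - s • d - y = (x - y) - s • d by abel, inner_sub_right, inner_smul_right] at h2
  rw [inner_sub_left] at h4
  have h6 : s * ((1 - ℓ * s) * ‖d‖ ^ 2) ≤ f x - f y - inner ℝ (gradient f y) (x - y) := by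
    nlinarith [mul_le_mul_of_nonneg_left h4 hs0.le]
  have h7 : 1 / 2 ≤ 1 - ℓ * s := by
    have : ℓ * s ≤ 1 / 2 := by
      rw [hs, mul_one_div, div_le_div_iff₀ (by positivity) (by norm_num)]
      linarith
    linarith
  have h8 : s * (1 / 2 * ‖d‖ ^ 2) ≤ f x - f y - inner ℝ (gradient f y) (x - y) :=
    (mul_le_mul_of_nonneg_left (mul_le_mul_of_nonneg_right h7 (sq_nonneg _)) hs0.le).trans h6
  have h9 : ‖d‖ ^ 2 = 4 * (ℓ + 1) * (s * (1 / 2 * ‖d‖ ^ 2)) := by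
    rw [hs]; field_simp; ring
  rw [h9]
  exact mul_le_mul_of_nonneg_left h8 (by positivity)

end Convex

/-! ### Saddle points and the Lagrangian gap -/

section Lagrangian

variable {X Y : Type*} [NormedAddCommGroup X] [InnerProductSpace ℝ X]
  [NormedAddCommGroup Y] [InnerProductSpace ℝ Y]
  {f : X → ℝ} {A : X →L[ℝ] Y} {b : Y} {β : ℝ} {p : X × Y}

theorem feasible_of_mem_primalDualSolutions (hp : p ∈ primalDualSolutions f A b) :
    A p.1 = b := by
  have h := (hp p.1 (p.2 + (A p.1 - b))).1
  simp only [lagrangian, inner_add_left, real_inner_self_eq_norm_sq] at h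
  have : ‖A p.1 - b‖ = 0 := by nlinarith [norm_nonneg (A p.1 - b)]
  rwa [norm_eq_zero, sub_eq_zero] at this

theorem hasFDerivAt_augLagrangian [CompleteSpace X] (hf : Differentiable ℝ f) (x : X) (μ : Y) :
    HasFDerivAt (fun z => augLagrangian f A b β z μ)
      (fderiv ℝ f x + (innerSL ℝ (μ + β • (A x - b))).comp A) x := by
  have hA : HasFDerivAt (fun z => A z - b) A x := A.hasFDerivAt.sub_const b
  have h := ((hf x).hasFDerivAt.add ((innerSL ℝ μ).hasFDerivAt.comp x hA)).add
    (hA.norm_sq.const_mul (β / 2))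
  refine h.congr_fderiv ?_
  ext w
  simp
  ring

theorem inner_gradient_augLagrangian [CompleteSpace X] (hf : Differentiable ℝ f) (x : X) (μ : Y)
    (w : X) :
    inner ℝ (gradient (fun z => augLagrangian f A b β z μ) x) w =
      inner ℝ (gradient f x) w + inner ℝ (μ + β • (A x - b)) (A w) := by
  rw [inner_gradient_left, (hasFDerivAt_augLagrangian hf x μ).fderiv, inner_gradient_left]
  rfl

theorem gradient_augLagrangian_dual [CompleteSpace Y] (x : X) (μ : Y) :
    gradient (fun ν => augLagrangian f A b β x ν) μ = A x - b := by
  refine HasGradientAt.gradient (hasGradientAt_iff_hasFDerivAt.2 ?_)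
  have h := (((innerSL ℝ (A x - b)).hasFDerivAt (x := μ)).const_add (f x)).add_const
    (β / 2 * ‖A x - b‖ ^ 2)
  refine (h.congr_fderiv (by ext w; simp)).congr_of_eventuallyEq
    (Eventually.of_forall fun ν => ?_)
  simp [augLagrangian, lagrangian, inner_sub_right, real_inner_comm ν]

/-- The optimality condition `∇f(x*) + A* μ* = 0`, tested against `w`. -/
theorem stationary_of_mem_primalDualSolutions [CompleteSpace X] (hf : Differentiable ℝ f)
    (hp : p ∈ primalDualSolutions f A b) (w : X) :
    inner ℝ (gradient f p.1) w + inner ℝ p.2 (A w) = 0 := by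
  have hmin : IsLocalMin (fun z => augLagrangian f A b 0 z p.2) p.1 :=
    Eventually.of_forall fun z => by
      simpa [augLagrangian] using (hp z p.2).2
  have h := inner_gradient_augLagrangian (A := A) (b := b) (β := 0) hf p.1 p.2 w
  rw [inner_gradient_left, hmin.fderiv_eq_zero] at h
  simpa using h.symm

/-- The gap `L_β(x, μ) - f(x*)` for the saddle point `p = (x*, μ)`; it is the difference
`L_β(x, μ) - L_β(x*, ν)` for every `ν`, because `x*` is feasible. -/
noncomputable def gap (f : X → ℝ) (A : X →L[ℝ] Y) (b : Y) (β : ℝ) (p : X × Y) (x : X) : ℝ :=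
  augLagrangian f A b β x p.2 - f p.1

/-- By stationarity at the saddle point, the gap is the Bregman distance of `f` plus the penalty. -/
theorem gap_eq [CompleteSpace X] (hf : Differentiable ℝ f) (hp : p ∈ primalDualSolutions f A b)
    (x : X) : gap f A b β p x =
      (f x - f p.1 - inner ℝ (gradient f p.1) (x - p.1)) + β / 2 * ‖A x - b‖ ^ 2 := by
  have h := stationary_of_mem_primalDualSolutions hf hp (x - p.1)
  rw [map_sub, feasible_of_mem_primalDualSolutions hp] at h
  simp only [gap, augLagrangian, lagrangian]
  linarith

theorem gap_nonneg [CompleteSpace X] (hf : Differentiable ℝ f) (hconv : ConvexOn ℝ univ f)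
    (hβ : 0 ≤ β) (hp : p ∈ primalDualSolutions f A b) (x : X) : 0 ≤ gap f A b β p x := by
  rw [gap_eq hf hp]
  have := add_inner_le_of_convexOn hconv hf p.1 x
  have : 0 ≤ β / 2 * ‖A x - b‖ ^ 2 := by positivity
  linarith

theorem norm_gradient_sub_sq_le_gap [CompleteSpace X] (hf : Differentiable ℝ f)
    (hconv : ConvexOn ℝ univ f) {ℓ : ℝ≥0} (hlip : LipschitzWith ℓ (gradient f)) (hβ : 0 ≤ β)
    (hp : p ∈ primalDualSolutions f A b) (x : X) :
    ‖gradient f x - gradient f p.1‖ ^ 2 ≤ 4 * (ℓ + 1) * gap f A b β p x := by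
  refine (norm_gradient_sub_sq_le hconv hf hlip x p.1).trans ?_
  refine mul_le_mul_of_nonneg_left ?_ (by positivity)
  rw [gap_eq hf hp]
  have : 0 ≤ β / 2 * ‖A x - b‖ ^ 2 := by positivity
  linarith

/-- The derivative of the gap at `x` in the direction `w`. -/
noncomputable def gapDeriv [CompleteSpace X] (f : X → ℝ) (A : X →L[ℝ] Y) (b : Y) (β : ℝ) (p : X × Y)
    (x w : X) : ℝ :=
  inner ℝ (gradient f x) w + inner ℝ (p.2 + β • (A x - b)) (A w)

theorem gapDeriv_add [CompleteSpace X] (x v w : X) :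
    gapDeriv f A b β p x (v + w) = gapDeriv f A b β p x v + gapDeriv f A b β p x w := by
  simp only [gapDeriv, map_add, inner_add_right]
  ring

theorem gapDeriv_smul [CompleteSpace X] (x v : X) (c : ℝ) :
    gapDeriv f A b β p x (c • v) = c * gapDeriv f A b β p x v := by
  simp only [gapDeriv, map_smul, inner_smul_right]
  ring

theorem hasDerivAt_gap [CompleteSpace X] (hf : Differentiable ℝ f) {x : ℝ → X} {x' : X} {t : ℝ}
    (hx : HasDerivAt x x' t) :
    HasDerivAt (fun s => gap f A b β p (x s)) (gapDeriv f A b β p (x t) x') t := by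
  refine (((hasFDerivAt_augLagrangian hf (x t) p.2).comp_hasDerivAt t hx).sub_const
    (f p.1)).congr_deriv ?_
  rw [gapDeriv, inner_gradient_left]
  rfl

theorem gap_add_gapDeriv_le [CompleteSpace X] (hf : Differentiable ℝ f)
    (hconv : ConvexOn ℝ univ f) (hβ : 0 ≤ β) (x y : X) :
    gap f A b β p x + gapDeriv f A b β p x (y - x) ≤ gap f A b β p y := by
  have h1 := add_inner_le_of_convexOn hconv hf x y
  have h2 : ‖A y - b‖ ^ 2 = ‖A x - b‖ ^ 2 + 2 * inner ℝ (A x - b) (A (y - x))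
      + ‖A (y - x)‖ ^ 2 := by
    rw [← norm_add_sq_real, map_sub]
    congr 2; abel
  have h3 : inner ℝ p.2 (A y - b) = inner ℝ p.2 (A x - b) + inner ℝ p.2 (A (y - x)) := by
    rw [← inner_add_right, map_sub]
    congr 1; abel
  have h4 : 0 ≤ β / 2 * ‖A (y - x)‖ ^ 2 := by positivity
  simp only [gap, gapDeriv, augLagrangian, lagrangian, inner_add_left, inner_smul_left, h2, h3,
    conj_trivial]
  linarith

theorem gap_self (hp : p ∈ primalDualSolutions f A b) : gap f A b β p p.1 = 0 := by
  simp [gap, augLagrangian, lagrangian, feasible_of_mem_primalDualSolutions hp]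

/-- A feasible `x` with zero gap, together with a multiplier `μ` for which `A* μ = A* μ*`, is a
saddle point: the Lagrangians with multipliers `μ` and `μ*` coincide. -/
theorem mem_primalDualSolutions_of_gap_nonpos (hp : p ∈ primalDualSolutions f A b) {q : X × Y}
    (hq₁ : A q.1 = b) (hgap : gap f A b β p q.1 ≤ 0)
    (hq₂ : ∀ w, inner ℝ (q.2 - p.2) (A w) = 0) : q ∈ primalDualSolutions f A b := by
  have hL : ∀ z, lagrangian f A b z q.2 = lagrangian f A b z p.2 := fun z => by
    have h := hq₂ (z - p.1)
    rw [map_sub, feasible_of_mem_primalDualSolutions hp, inner_sub_left] at h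
    simp only [lagrangian]
    linarith
  intro z μ
  refine ⟨by simp [lagrangian, hq₁], ?_⟩
  rw [hL z]
  refine le_trans ?_ (hp z p.2).2
  simp only [gap, augLagrangian, lagrangian, hq₁, sub_self, inner_zero_right, norm_zero] at hgap
  simp only [lagrangian, hq₁, feasible_of_mem_primalDualSolutions hp, sub_self, inner_zero_right]
  linarith

end Lagrangian

/-! ### The energy of a trajectory -/

section Energy

variable {X Y : Type*} [NormedAddCommGroup X] [InnerProductSpace ℝ X]
  [NormedAddCommGroup Y] [InnerProductSpace ℝ Y]

/-- Half the squared distance of the trajectory to `p`. -/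
noncomputable def anchor (p : X × Y) (x : ℝ → X) (lam : ℝ → Y) (t : ℝ) : ℝ :=
  1 / 2 * (‖x t - p.1‖ ^ 2 + ‖lam t - p.2‖ ^ 2)

/-- The gap plus the kinetic energy. -/
noncomputable def mechanicalEnergy (f : X → ℝ) (A : X →L[ℝ] Y) (b : Y) (β : ℝ) (p : X × Y)
    (x x' : ℝ → X) (lam' : ℝ → Y) (t : ℝ) : ℝ :=
  gap f A b β p (x t) + 1 / 2 * (‖x' t‖ ^ 2 + ‖lam' t‖ ^ 2)

/-- The Lyapunov function of the system. -/
noncomputable def energy (f : X → ℝ) (A : X →L[ℝ] Y) (b : Y) (α β θ : ℝ) (p : X × Y)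
    (x x' : ℝ → X) (lam lam' : ℝ → Y) (t : ℝ) : ℝ :=
  θ ^ 2 * t ^ 2 * gap f A b β p (x t)
    + 1 / 2 * (‖x t - p.1 + (θ * t) • x' t‖ ^ 2 + ‖lam t - p.2 + (θ * t) • lam' t‖ ^ 2)
    + (θ * (α - 1) - 1) * anchor p x lam t

theorem energy_eq {f : X → ℝ} {A : X →L[ℝ] Y} {b : Y} {α β θ : ℝ} {x x' : ℝ → X}
    {lam lam' : ℝ → Y} (p : X × Y) (t : ℝ) : energy f A b α β θ p x x' lam lam' t =
    θ * (t * (inner ℝ (x t - p.1) (x' t) + inner ℝ (lam t - p.2) (lam' t)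
        + θ * t * mechanicalEnergy f A b β p x x' lam' t)
      + (α - 1) * anchor p x lam t) := by
  simp only [energy, mechanicalEnergy, anchor, norm_add_sq_real, inner_smul_right, norm_smul,
    mul_pow, Real.norm_eq_abs, sq_abs]
  ring

end Energy

section Flow

variable {X Y : Type*} [NormedAddCommGroup X] [InnerProductSpace ℝ X] [CompleteSpace X]
  [NormedAddCommGroup Y] [InnerProductSpace ℝ Y]

/-- The dynamical system on the open half-line `(t₀, ∞)`, with the derivatives of the trajectory
given explicitly. The primal equation is tested against vectors `w`, so that no adjoint of `A`
appears. -/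
structure IsFlow (f : X → ℝ) (A : X →L[ℝ] Y) (b : Y) (α β θ t₀ : ℝ)
    (x x' x'' : ℝ → X) (lam lam' lam'' : ℝ → Y) : Prop where
  hasDerivAt_primal : ∀ t, t₀ < t → HasDerivAt x (x' t) t
  hasDerivAt_primal' : ∀ t, t₀ < t → HasDerivAt x' (x'' t) t
  hasDerivAt_dual : ∀ t, t₀ < t → HasDerivAt lam (lam' t) t
  hasDerivAt_dual' : ∀ t, t₀ < t → HasDerivAt lam' (lam'' t) t
  primal_eq : ∀ t, t₀ < t → ∀ w, inner ℝ (x'' t + (α / t) • x' t + gradient f (x t)) w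
    + inner ℝ (lam t + (θ * t) • lam' t + β • (A (x t) - b)) (A w) = 0
  dual_eq : ∀ t, t₀ < t → lam'' t + (α / t) • lam' t = A (x t + (θ * t) • x' t) - b

variable {f : X → ℝ} {A : X →L[ℝ] Y} {b : Y} {α β θ t₀ T : ℝ}
  {x x' x'' : ℝ → X} {lam lam' lam'' : ℝ → Y} {p : X × Y} {t : ℝ}

theorem hasDerivAt_anchor (h : IsFlow f A b α β θ t₀ x x' x'' lam lam' lam'') (ht : t₀ < t) :
    HasDerivAt (anchor p x lam)
      (inner ℝ (x t - p.1) (x' t) + inner ℝ (lam t - p.2) (lam' t)) t := by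
  refine ((((h.hasDerivAt_primal t ht).sub_const p.1).norm_sq.add
    ((h.hasDerivAt_dual t ht).sub_const p.2).norm_sq).const_mul (1 / 2)).congr_deriv ?_
  ring

/-- In the derivative of the energy the coupling terms of the two equations cancel: this is what
the extrapolations `lam + θ t lam'` and `x + θ t x'` in the system are for. -/
theorem hasDerivAt_energy (hf : Differentiable ℝ f) (hp : p ∈ primalDualSolutions f A b)
    (h : IsFlow f A b α β θ t₀ x x' x'' lam lam' lam'') (ht0 : 0 < t) (ht : t₀ < t) :
    HasDerivAt (energy f A b α β θ p x x' lam lam')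
      (2 * θ ^ 2 * t * gap f A b β p (x t) - θ * t * gapDeriv f A b β p (x t) (x t - p.1)
        - (θ * (α - 1) - 1) * (θ * t) * (‖x' t‖ ^ 2 + ‖lam' t‖ ^ 2)) t := by
  have hmul : HasDerivAt (fun s : ℝ => θ * s) θ t := by
    simpa using (hasDerivAt_id t).const_mul θ
  have hsq : HasDerivAt (fun s : ℝ => θ ^ 2 * s ^ 2) (2 * θ ^ 2 * t) t :=
    ((hasDerivAt_pow 2 t).const_mul (θ ^ 2)).congr_deriv (by simp; ring)
  have hx := ((h.hasDerivAt_primal t ht).sub_const p.1).add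
    (hmul.smul (h.hasDerivAt_primal' t ht))
  have hl := ((h.hasDerivAt_dual t ht).sub_const p.2).add
    (hmul.smul (h.hasDerivAt_dual' t ht))
  refine (((hsq.mul (hasDerivAt_gap (A := A) (b := b) (β := β) (p := p) hf
    (h.hasDerivAt_primal t ht))).add ((hx.norm_sq.add hl.norm_sq).const_mul (1 / 2))).add
    ((hasDerivAt_anchor (p := p) h ht).const_mul (θ * (α - 1) - 1))).congr_deriv ?_
  simp only [Pi.add_apply, Pi.smul_apply']
  set u := x t - p.1 + (θ * t) • x' t with hu
  set m := lam t - p.2 + (θ * t) • lam' t with hm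
  have hAu : A (x t + (θ * t) • x' t) - b = A u := by
    rw [← feasible_of_mem_primalDualSolutions hp, ← map_sub, hu]
    congr 1; abel
  have hml : lam t + (θ * t) • lam' t = m + p.2 := by rw [hm]; abel
  have e1 := h.primal_eq t ht u
  have e2 := congrArg (fun v => inner ℝ v m) (h.dual_eq t ht)
  simp only [hAu] at e2
  have e3 : gapDeriv f A b β p (x t) u =
      inner ℝ (gradient f (x t)) u + inner ℝ (p.2 + β • (A (x t) - b)) (A u) := rfl
  have e4 : gapDeriv f A b β p (x t) u = gapDeriv f A b β p (x t) (x t - p.1)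
      + θ * t * gapDeriv f A b β p (x t) (x' t) := by
    rw [hu, gapDeriv_add, gapDeriv_smul]
  have e5 : inner ℝ u (x' t) = inner ℝ (x t - p.1) (x' t) + θ * t * ‖x' t‖ ^ 2 := by
    rw [hu, inner_add_left, inner_smul_left, real_inner_self_eq_norm_sq]; rfl
  have e6 : inner ℝ m (lam' t) = inner ℝ (lam t - p.2) (lam' t) + θ * t * ‖lam' t‖ ^ 2 := by
    rw [hm, inner_add_left, inner_smul_left, real_inner_self_eq_norm_sq]; rfl
  rw [hml, add_assoc m, inner_add_left m] at e1
  simp only [inner_add_left (𝕜 := ℝ) (_ + _) _ u, inner_add_left (𝕜 := ℝ) (x'' t),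
    inner_add_left (𝕜 := ℝ) (lam'' t), real_inner_comm u,
    real_inner_comm m, inner_smul_right] at e1 e2
  simp only [inner_add_right, inner_smul_right]
  rw [real_inner_comm u (gradient f (x t))] at e3
  have htα : t * (α / t) = α := by field_simp
  linear_combination (θ * t) * e1 + (θ * t) * e2 + (θ * t) * e3 - (θ * t) * e4
    - (θ * (α - 1) - 1) * e5 - (θ * (α - 1) - 1) * e6
    - θ * (inner ℝ u (x' t) + inner ℝ m (lam' t)) * htα

theorem mechanicalEnergy_nonneg (hf : Differentiable ℝ f) (hconv : ConvexOn ℝ univ f)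
    (hβ : 0 ≤ β) (hp : p ∈ primalDualSolutions f A b) (t : ℝ) :
    0 ≤ mechanicalEnergy f A b β p x x' lam' t := by
  have := gap_nonneg (β := β) hf hconv hβ hp (x t)
  unfold mechanicalEnergy
  positivity

/-- The energy decreases at a rate proportional to `t` times the mechanical energy; this is where
the strict inequalities `1 / (α - 1) < θ < 1 / 2` enter. -/
theorem energy_deriv_le (hf : Differentiable ℝ f) (hconv : ConvexOn ℝ univ f)
    (hβ : 0 ≤ β) (hθ : 0 < θ) (hp : p ∈ primalDualSolutions f A b) (ht0 : 0 < t) {c : ℝ}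
    (hc₁ : c ≤ 1 - 2 * θ) (hc₂ : c ≤ 2 * (θ * (α - 1) - 1)) :
    2 * θ ^ 2 * t * gap f A b β p (x t) - θ * t * gapDeriv f A b β p (x t) (x t - p.1)
        - (θ * (α - 1) - 1) * (θ * t) * (‖x' t‖ ^ 2 + ‖lam' t‖ ^ 2)
      ≤ -(c * (θ * t * mechanicalEnergy f A b β p x x' lam' t)) := by
  have h1 := gap_add_gapDeriv_le (A := A) (b := b) (p := p) hf hconv hβ (x t) p.1
  rw [gap_self hp, ← neg_sub (x t), ← neg_one_smul ℝ (x t - p.1), gapDeriv_smul] at h1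
  have hθt : 0 < θ * t := mul_pos hθ ht0
  have h2 := mul_le_mul_of_nonneg_left h1 hθt.le
  have h3 := mul_le_mul_of_nonneg_right hc₁
    (mul_nonneg hθt.le (gap_nonneg (β := β) hf hconv hβ hp (x t)))
  have h4 := mul_le_mul_of_nonneg_right hc₂
    (show 0 ≤ θ * t * (1 / 2 * (‖x' t‖ ^ 2 + ‖lam' t‖ ^ 2)) by positivity)
  unfold mechanicalEnergy
  linarith

theorem energy_nonneg (hf : Differentiable ℝ f) (hconv : ConvexOn ℝ univ f)
    (hβ : 0 ≤ β) (hξ : 0 ≤ θ * (α - 1) - 1) (hp : p ∈ primalDualSolutions f A b) (t : ℝ) :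
    0 ≤ energy f A b α β θ p x x' lam lam' t := by
  have := gap_nonneg (β := β) hf hconv hβ hp (x t)
  unfold energy anchor
  positivity

theorem antitoneOn_energy (hf : Differentiable ℝ f) (hconv : ConvexOn ℝ univ f)
    (hβ : 0 ≤ β) (hθ : 0 < θ) (hθ₂ : θ < 1 / 2) (hξ : 0 ≤ θ * (α - 1) - 1)
    (hp : p ∈ primalDualSolutions f A b) (h : IsFlow f A b α β θ t₀ x x' x'' lam lam' lam'')
    (hT0 : 0 < T) (hT : t₀ < T) :
    AntitoneOn (energy f A b α β θ p x x' lam lam') (Ici T) := by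
  have := monotoneOn_of_hasDerivAt_nonneg
    (fun t ht => (hasDerivAt_energy hf hp h (hT0.trans_le ht) (hT.trans_le ht)).neg)
    fun t ht => by
      have := energy_deriv_le (x := x) (x' := x') (lam' := lam') (α := α) (c := 0) hf hconv hβ hθ hp
        (hT0.trans_le ht) (by linarith) (by linarith)
      linarith
  simpa only [Pi.neg_apply, neg_neg] using this.neg

theorem continuousOn_mechanicalEnergy (hf : Differentiable ℝ f)
    (h : IsFlow f A b α β θ t₀ x x' x'' lam lam' lam'') :
    ContinuousOn (mechanicalEnergy f A b β p x x' lam') (Ioi t₀) := fun t ht =>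
  (((hasDerivAt_gap hf (h.hasDerivAt_primal t ht)).continuousAt).add
    ((((h.hasDerivAt_primal' t ht).continuousAt.norm.pow 2).add
      ((h.hasDerivAt_dual' t ht).continuousAt.norm.pow 2)).const_mul (1 / 2))).continuousWithinAt

/-- A primitive of `θ t` times the mechanical energy converges, since the energy pays for it. -/
theorem exists_convergent_primitive (hf : Differentiable ℝ f) (hconv : ConvexOn ℝ univ f)
    (hβ : 0 ≤ β) (hθ : 0 < θ) (hθ₂ : θ < 1 / 2) (hξ : 0 < θ * (α - 1) - 1)
    (hp : p ∈ primalDualSolutions f A b) (h : IsFlow f A b α β θ t₀ x x' x'' lam lam' lam'')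
    (hT0 : 0 < T) (hT : t₀ < T) :
    ∃ R : ℝ → ℝ, (∀ t, T ≤ t →
        HasDerivAt R (θ * t * mechanicalEnergy f A b β p x x' lam' t) t) ∧
      ∃ r, Tendsto R atTop (𝓝 r) := by
  obtain ⟨R, hR⟩ := exists_primitive hT (((continuous_const.mul continuous_id).continuousOn).mul
    (continuousOn_mechanicalEnergy (p := p) hf h) : ContinuousOn
      (fun t => θ * t * mechanicalEnergy f A b β p x x' lam' t) (Ioi t₀))
  have hW := mechanicalEnergy_nonneg (x := x) (x' := x') (lam' := lam') hf hconv hβ hp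
  refine ⟨R, hR, ?_⟩
  obtain ⟨c, hc0, hc₁, hc₂⟩ : ∃ c : ℝ, 0 < c ∧ c ≤ 1 - 2 * θ ∧ c ≤ 2 * (θ * (α - 1) - 1) :=
    ⟨min (1 - 2 * θ) (2 * (θ * (α - 1) - 1)), lt_min (by linarith) (by linarith),
      min_le_left _ _, min_le_right _ _⟩
  have hmono := monotoneOn_of_hasDerivAt_nonneg
    (fun t ht => ((hasDerivAt_energy hf hp h (hT0.trans_le ht) (hT.trans_le ht)).add
      ((hR t ht).const_mul c)).neg)
    fun t ht => by
      have := energy_deriv_le (x := x) (x' := x') (lam' := lam') hf hconv hβ hθ hp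
        (hT0.trans_le ht) hc₁ hc₂
      simp only [Pi.mul_apply, id_eq]
      linarith
  refine exists_tendsto_of_monotoneOn_Ici
    (M := (energy f A b α β θ p x x' lam lam' T + c * R T) / c)
    (monotoneOn_of_hasDerivAt_nonneg hR fun t ht =>
      mul_nonneg (mul_nonneg hθ.le (hT0.trans_le ht).le) (hW t)) fun t ht => ?_
  have h1 := hmono self_mem_Ici ht ht
  have h2 := energy_nonneg (x := x) (x' := x') (lam := lam) (lam' := lam') hf hconv hβ hξ.le hp t
  simp only [Pi.neg_apply, Pi.add_apply] at h1
  rw [le_div_iff₀ hc0]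
  linarith

/-- The distance to each saddle point converges. With `φ` half the squared distance, `W` the
mechanical energy and `R' = θ t W`, the energy is `θ (t (φ + R)' + (α - 1) φ)`; as the energy and
`R` converge, so does `φ + R`. -/
theorem exists_tendsto_anchor (hf : Differentiable ℝ f) (hconv : ConvexOn ℝ univ f)
    (hβ : 0 ≤ β) (hα : 1 < α) (hθ : 0 < θ) (hθ₂ : θ < 1 / 2) (hξ : 0 < θ * (α - 1) - 1)
    (hp : p ∈ primalDualSolutions f A b) (h : IsFlow f A b α β θ t₀ x x' x'' lam lam' lam'')
    (hT0 : 0 < T) (hT : t₀ < T) : ∃ l, Tendsto (anchor p x lam) atTop (𝓝 l) := by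
  obtain ⟨R, hR, r, hr⟩ := exists_convergent_primitive hf hconv hβ hθ hθ₂ hξ hp h hT0 hT
  obtain ⟨e, he⟩ := exists_tendsto_of_monotoneOn_Ici (M := 0)
    (antitoneOn_energy hf hconv hβ hθ hθ₂ hξ.le hp h hT0 hT).neg fun t _ =>
      neg_nonpos.2 (energy_nonneg hf hconv hβ hξ.le hp t)
  have hlim := tendsto_of_euler (a := α - 1) (L := -e / θ + (α - 1) * r) hT0 (by linarith)
    (fun t ht => (hasDerivAt_anchor (p := p) h (hT.trans_le ht)).add (hR t ht)) (by
      refine ((he.neg.div_const θ).add (hr.const_mul (α - 1))).congr fun t => ?_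
      simp only [Pi.add_apply, neg_neg, energy_eq]
      field_simp
      ring)
  exact ⟨_, (hlim.sub hr).congr fun t => by simp⟩

theorem norm_smul_le_div {E : Type*} [NormedAddCommGroup E] [NormedSpace ℝ E] {u v : E}
    {D D' : ℝ} (hθ : 0 < θ) (h₁ : ‖u + (θ * t) • v‖ ≤ D) (h₂ : ‖u‖ ≤ D') :
    ‖t • v‖ ≤ (D + D') / θ := by
  have h₃ := norm_sub_le (u + (θ * t) • v) u
  rw [mul_smul] at h₁ h₃
  rw [add_sub_cancel_left, norm_smul, Real.norm_of_nonneg hθ.le] at h₃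
  rw [le_div_iff₀ hθ]
  linarith

/-- Bounds on the trajectory: positions and `t` times the velocities are bounded, and the gap is
`O(1 / t²)`. -/
theorem exists_bound (hf : Differentiable ℝ f) (hconv : ConvexOn ℝ univ f)
    (hβ : 0 ≤ β) (hθ : 0 < θ) (hθ₂ : θ < 1 / 2) (hξ : 0 < θ * (α - 1) - 1)
    (hp : p ∈ primalDualSolutions f A b) (h : IsFlow f A b α β θ t₀ x x' x'' lam lam' lam'')
    (hT0 : 0 < T) (hT : t₀ < T) :
    ∃ C, 0 ≤ C ∧ ∀ t, T ≤ t → t ^ 2 * gap f A b β p (x t) ≤ C ∧ ‖x t‖ ≤ C ∧ ‖lam t‖ ≤ C ∧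
      ‖t • x' t‖ ≤ C ∧ ‖t • lam' t‖ ≤ C := by
  set ξ := θ * (α - 1) - 1 with hξ_def
  set E := energy f A b α β θ p x x' lam lam' with hE
  have hE0 : 0 ≤ E T := energy_nonneg hf hconv hβ hξ.le hp T
  set D := √(2 * E T) with hD
  set D' := √(2 * E T / ξ) with hD'
  -- the constant is the sum of the bounds obtained for the individual quantities
  refine ⟨E T / θ ^ 2 + (D' + ‖p.1‖) + (D' + ‖p.2‖) + 2 * ((D + D') / θ), by positivity,
    fun t ht => ?_⟩
  have ht0 : 0 < t := hT0.trans_le ht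
  have hle : E t ≤ E T := antitoneOn_energy hf hconv hβ hθ hθ₂ hξ.le hp h hT0 hT self_mem_Ici ht ht
  have hgap := gap_nonneg (β := β) hf hconv hβ hp (x t)
  rw [show E t = θ ^ 2 * t ^ 2 * gap f A b β p (x t)
    + 1 / 2 * (‖x t - p.1 + (θ * t) • x' t‖ ^ 2 + ‖lam t - p.2 + (θ * t) • lam' t‖ ^ 2)
    + ξ * (1 / 2 * (‖x t - p.1‖ ^ 2 + ‖lam t - p.2‖ ^ 2)) from rfl] at hle
  have g0 : 0 ≤ θ ^ 2 * t ^ 2 * gap f A b β p (x t) := by positivity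
  have g1 := sq_nonneg ‖x t - p.1 + (θ * t) • x' t‖
  have g2 := sq_nonneg ‖lam t - p.2 + (θ * t) • lam' t‖
  have g3 : 0 ≤ ξ * ‖x t - p.1‖ ^ 2 := by positivity
  have g4 : 0 ≤ ξ * ‖lam t - p.2‖ ^ 2 := by positivity
  have b0 : t ^ 2 * gap f A b β p (x t) ≤ E T / θ ^ 2 := by
    rw [le_div_iff₀ (by positivity)]; linarith
  have b1 : ‖x t - p.1 + (θ * t) • x' t‖ ≤ D := Real.le_sqrt_of_sq_le (by linarith)
  have b2 : ‖lam t - p.2 + (θ * t) • lam' t‖ ≤ D := Real.le_sqrt_of_sq_le (by linarith)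
  have b3 : ‖x t - p.1‖ ≤ D' := Real.le_sqrt_of_sq_le (by rw [le_div_iff₀ hξ]; linarith)
  have b4 : ‖lam t - p.2‖ ≤ D' := Real.le_sqrt_of_sq_le (by rw [le_div_iff₀ hξ]; linarith)
  have n1 : 0 ≤ E T / θ ^ 2 := by positivity
  have n2 : 0 ≤ (D + D') / θ := by positivity
  have n3 := norm_nonneg p.1
  have n4 := norm_nonneg p.2
  have n5 : 0 ≤ D' := Real.sqrt_nonneg _
  have b5 := norm_smul_le_div hθ b1 b3
  have b6 := norm_smul_le_div hθ b2 b4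
  have b7 := norm_le_norm_sub_add (x t) p.1
  have b8 := norm_le_norm_sub_add (lam t) p.2
  refine ⟨?_, ?_, ?_, ?_, ?_⟩ <;> linarith

end Flow

/-! ### Asymptotic feasibility and stationarity -/

section Asymptotics

variable {X Y : Type*} [NormedAddCommGroup X] [InnerProductSpace ℝ X] [CompleteSpace X]
  [NormedAddCommGroup Y] [InnerProductSpace ℝ Y]
  {f : X → ℝ} {A : X →L[ℝ] Y} {b : Y} {α β θ t₀ T C : ℝ}
  {x x' x'' : ℝ → X} {lam lam' lam'' : ℝ → Y} {p : X × Y}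

theorem le_div_mul_of_le {B T t : ℝ} (hT : 0 < T) (hB : 0 ≤ B) (ht : T ≤ t) : B ≤ B / T * t := by
  rw [div_mul_eq_mul_div, le_div_iff₀ hT]
  exact mul_le_mul_of_nonneg_left ht hB

theorem abs_mul_inner_le {E : Type*} [NormedAddCommGroup E] [InnerProductSpace ℝ E] {v : E}
    {t : ℝ} (h : ‖t • v‖ ≤ C) (w : E) : |t * inner ℝ v w| ≤ C * ‖w‖ := by
  rw [← real_inner_smul_left]
  exact (abs_real_inner_le_norm _ _).trans (mul_le_mul_of_nonneg_right h (norm_nonneg w))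

/-- Multiplied by `t`, the dual equation says that
`θ t² ⟪A x - b, w⟫ + (1 - 2 θ) ∫ s ⟪A x - b, w⟫ ds - t ⟪lam', w⟫ - (α - 1) ⟪lam, w⟫` is constant.
Hence the trajectory is asymptotically feasible. -/
theorem tendsto_inner_residual (hθ : 0 < θ) (hθ₂ : θ < 1 / 2) (hα : 1 < α)
    (h : IsFlow f A b α β θ t₀ x x' x'' lam lam' lam'') (hT0 : 0 < T) (hT : t₀ < T)
    (hC : 0 ≤ C) (hl : ∀ t, T ≤ t → ‖lam t‖ ≤ C) (hl' : ∀ t, T ≤ t → ‖t • lam' t‖ ≤ C) (w : Y) :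
    (∃ Q : ℝ → ℝ, (∀ t, T ≤ t → HasDerivAt Q (t * inner ℝ (A (x t) - b) w) t) ∧
      ∃ M, 0 ≤ M ∧ ∀ t, T ≤ t → |Q t| ≤ M * t) ∧
    Tendsto (fun t => inner ℝ (A (x t) - b) w) atTop (𝓝 0) := by
  have hq : ∀ t, t₀ < t →
      HasDerivAt (fun t => inner ℝ (A (x t) - b) w) (inner ℝ (A (x' t)) w) t := fun t ht => by
    simpa using ((A.hasFDerivAt.comp_hasDerivAt t (h.hasDerivAt_primal t ht)).sub_const b).inner ℝ
      (hasDerivAt_const t w)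
  obtain ⟨Q, hQ⟩ := exists_primitive (g := fun t => t * inner ℝ (A (x t) - b) w) hT fun t ht =>
    (continuousAt_id.mul (hq t ht).continuousAt).continuousWithinAt
  set k : ℝ → ℝ := fun t => θ * t ^ 2 * inner ℝ (A (x t) - b) w + (1 - 2 * θ) * Q t
    - t * inner ℝ (lam' t) w - (α - 1) * inner ℝ (lam t) w with hk
  have hk' : ∀ t, T ≤ t → HasDerivAt k 0 t := fun t ht => by
    have ht' := hT.trans_le ht
    have ht0 : 0 < t := hT0.trans_le ht
    have d1 := ((hasDerivAt_pow 2 t).const_mul θ).mul (hq t ht')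
    have d2 := (hasDerivAt_id t).mul ((h.hasDerivAt_dual' t ht').inner ℝ (hasDerivAt_const t w))
    have d3 := ((h.hasDerivAt_dual t ht').inner ℝ (hasDerivAt_const t w)).const_mul (α - 1)
    refine (((d1.add ((hQ t ht).const_mul (1 - 2 * θ))).sub d2).sub d3).congr_deriv ?_
    have e := congrArg (fun v => inner ℝ v w) (h.dual_eq t ht')
    simp only [map_add, map_smul, add_sub_right_comm _ _ b] at e
    simp only [inner_add_left (𝕜 := ℝ) (A (x t) - b), inner_add_left (𝕜 := ℝ) (lam'' t),
      real_inner_smul_left] at e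
    have htα : t * (α / t) = α := by field_simp
    simp only [inner_zero_right, zero_add, id_eq, Nat.cast_ofNat, Nat.add_one_sub_one, pow_one]
    linear_combination (-t) * e + inner ℝ (lam' t) w * htα
  -- `B` bounds what remains of the identity `k t = k T` besides the terms with `A x - b`, and `B ≤ B / T * t`
  set B := |k T| + C * ‖w‖ + (α - 1) * (C * ‖w‖) with hB
  have hα' : 0 ≤ α - 1 := by linarith
  have hB0 : 0 ≤ B := by positivity
  have hmain := tendsto_zero_of_combination (c := 1 - 2 * θ) (K := B / T) hT0 (by linarith) hθ
    (by positivity) hQ fun t ht => by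
      refine le_trans ?_ (le_div_mul_of_le hT0 hB0 ht)
      have e : θ * t ^ 2 * inner ℝ (A (x t) - b) w + (1 - 2 * θ) * Q t
          = k T + t * inner ℝ (lam' t) w + (α - 1) * inner ℝ (lam t) w := by
        rw [← eq_of_hasDerivAt_zero hk' ht, hk]; ring
      rw [e]
      refine (abs_add_le _ _).trans (add_le_add ((abs_add_le _ _).trans (add_le_add le_rfl
        (abs_mul_inner_le (hl' t ht) w))) ?_)
      rw [abs_mul, abs_of_nonneg hα']
      exact mul_le_mul_of_nonneg_left ((abs_real_inner_le_norm _ _).trans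
        (mul_le_mul_of_nonneg_right (hl t ht) (norm_nonneg w))) hα'
  exact ⟨⟨Q, hQ, hmain.1⟩, hmain.2⟩

/-- The same argument for the primal equation. The gradients enter through an integral that grows
at most linearly, because `‖∇f(x) - ∇f(x*)‖` is `O(1 / t)` by cocoercivity. -/
theorem tendsto_inner_multiplier (hf : Differentiable ℝ f) (hgrad : Continuous (gradient f))
    (hθ : 0 < θ) (hθ₂ : θ < 1 / 2) (hα : 1 < α) (hβ : 0 ≤ β)
    (hp : p ∈ primalDualSolutions f A b)
    (h : IsFlow f A b α β θ t₀ x x' x'' lam lam' lam'') (hT0 : 0 < T) (hT : t₀ < T)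
    (hC : 0 ≤ C) (hx : ∀ t, T ≤ t → ‖x t‖ ≤ C) (hx' : ∀ t, T ≤ t → ‖t • x' t‖ ≤ C)
    (hl : ∀ t, T ≤ t → ‖lam t‖ ≤ C) (hl' : ∀ t, T ≤ t → ‖t • lam' t‖ ≤ C)
    (hg : ∀ t, T ≤ t → ‖t • (gradient f (x t) - gradient f p.1)‖ ≤ C) (w : X) :
    Tendsto (fun t => inner ℝ (lam t - p.2) (A w)) atTop (𝓝 0) := by
  have hq : ∀ t, t₀ < t →
      HasDerivAt (fun t => inner ℝ (lam t - p.2) (A w)) (inner ℝ (lam' t) (A w)) t :=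
    fun t ht => by
      simpa using ((h.hasDerivAt_dual t ht).sub_const p.2).inner ℝ (hasDerivAt_const t (A w))
  obtain ⟨Q, hQ⟩ := exists_primitive (g := fun t => t * inner ℝ (lam t - p.2) (A w)) hT
    fun t ht => (continuousAt_id.mul (hq t ht).continuousAt).continuousWithinAt
  obtain ⟨G, hG⟩ := exists_primitive
    (g := fun t => t * inner ℝ (gradient f (x t) - gradient f p.1) w) hT fun t ht =>
      (continuousAt_id.mul (((hgrad.continuousAt.comp
        (h.hasDerivAt_primal t ht).continuousAt).sub continuousAt_const).inner
          continuousAt_const)).continuousWithinAt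
  obtain ⟨N, hN0, hN⟩ := abs_le_mul_of_abs_deriv_le (K := C * ‖w‖) hT0 (by positivity) hG
    fun t ht => abs_mul_inner_le (hg t ht) w
  obtain ⟨⟨P, hP, M, hM0, hM⟩, -⟩ :=
    tendsto_inner_residual hθ hθ₂ hα h hT0 hT hC hl hl' (A w)
  set k : ℝ → ℝ := fun t => θ * t ^ 2 * inner ℝ (lam t - p.2) (A w) + (1 - 2 * θ) * Q t
    + t * inner ℝ (x' t) w + (α - 1) * inner ℝ (x t) w + G t + β * P t with hk
  have hk' : ∀ t, T ≤ t → HasDerivAt k 0 t := fun t ht => by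
    have ht' := hT.trans_le ht
    have ht0 : 0 < t := hT0.trans_le ht
    have d1 := ((hasDerivAt_pow 2 t).const_mul θ).mul (hq t ht')
    have d2 := (hasDerivAt_id t).mul
      ((h.hasDerivAt_primal' t ht').inner ℝ (hasDerivAt_const t w))
    have d3 := ((h.hasDerivAt_primal t ht').inner ℝ (hasDerivAt_const t w)).const_mul (α - 1)
    refine (((((d1.add ((hQ t ht).const_mul (1 - 2 * θ))).add d2).add d3).add (hG t ht)).add
      ((hP t ht).const_mul β)).congr_deriv ?_
    have e := h.primal_eq t ht' w
    have e' := stationary_of_mem_primalDualSolutions hf hp w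
    have htα : t * (α / t) = α := by field_simp
    simp only [inner_add_left (𝕜 := ℝ) (lam t + _), inner_add_left (𝕜 := ℝ) (lam t),
      inner_add_left (𝕜 := ℝ) (x'' t + _), inner_add_left (𝕜 := ℝ) (x'' t),
      real_inner_smul_left] at e
    simp only [inner_zero_right, zero_add, id_eq, Nat.cast_ofNat, Nat.add_one_sub_one, pow_one,
      inner_sub_left (𝕜 := ℝ) (lam t), inner_sub_left (𝕜 := ℝ) (gradient f (x t))]
    linear_combination t * e - t * e' - inner ℝ (x' t) w * htα
  set B := |k T| + C * ‖w‖ + (α - 1) * (C * ‖w‖) with hB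
  have hα' : 0 ≤ α - 1 := by linarith
  have hB0 : 0 ≤ B := by positivity
  refine (tendsto_zero_of_combination (c := 1 - 2 * θ) (K := B / T + N + β * M) hT0 (by linarith)
    hθ (by positivity) hQ fun t ht => ?_).2
  have e : θ * t ^ 2 * inner ℝ (lam t - p.2) (A w) + (1 - 2 * θ) * Q t
      = k T - t * inner ℝ (x' t) w - (α - 1) * inner ℝ (x t) w - G t - β * P t := by
    rw [← eq_of_hasDerivAt_zero hk' ht, hk]; ring
  have i1 := abs_le.1 (abs_mul_inner_le (hx' t ht) w)
  have i2 := abs_le.1 ((abs_real_inner_le_norm (x t) w).trans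
    (mul_le_mul_of_nonneg_right (hx t ht) (norm_nonneg w)))
  have i3 := abs_le.1 (hN t ht)
  have i4 := abs_le.1 (hM t ht)
  have i5 := le_div_mul_of_le hT0 hB0 ht
  have i6 := abs_le.1 (le_refl |k T|)
  have j1 := mul_le_mul_of_nonneg_left i2.1 hα'
  have j2 := mul_le_mul_of_nonneg_left i2.2 hα'
  have j3 := mul_le_mul_of_nonneg_left i4.1 hβ
  have j4 := mul_le_mul_of_nonneg_left i4.2 hβ
  rw [e, abs_le]
  constructor <;> linarith

/-- Every weak limit point of the trajectory is a saddle point. -/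
theorem mem_primalDualSolutions_of_weak_limit (hf : Differentiable ℝ f)
    (hconv : ConvexOn ℝ univ f) (hβ : 0 ≤ β) {ι : Type*} {U : Filter ι} [U.NeBot]
    [CompleteSpace Y] (hp : p ∈ primalDualSolutions f A b) {x : ι → X} {lam : ι → Y} {q : X × Y}
    (hgap : Tendsto (fun i => gap f A b β p (x i)) U (𝓝 0))
    (hres : ∀ w, Tendsto (fun i => inner ℝ (A (x i) - b) w) U (𝓝 0))
    (hmul : ∀ w, Tendsto (fun i => inner ℝ (lam i - p.2) (A w)) U (𝓝 0))
    (hx : ∀ w, Tendsto (fun i => inner ℝ (x i) w) U (𝓝 (inner ℝ q.1 w)))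
    (hl : ∀ w, Tendsto (fun i => inner ℝ (lam i) w) U (𝓝 (inner ℝ q.2 w))) :
    q ∈ primalDualSolutions f A b := by
  refine mem_primalDualSolutions_of_gap_nonpos (β := β) hp ?_ ?_ fun w => ?_
  · rw [← sub_eq_zero]
    refine ext_inner_right ℝ fun w => ?_
    rw [inner_zero_left]
    refine tendsto_nhds_unique ?_ (hres w)
    simp only [inner_sub_left, ← ContinuousLinearMap.adjoint_inner_right]
    exact (hx _).sub_const _
  · -- weak lower semicontinuity of the gap, through its tangent at `q.1`
    have hD : Tendsto (fun i => gap f A b β p q.1 + gapDeriv f A b β p q.1 (x i - q.1)) U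
        (𝓝 (gap f A b β p q.1 + 0)) := by
      refine tendsto_const_nhds.add ?_
      have hrepr : ∀ v, gapDeriv f A b β p q.1 v = inner ℝ v (gradient f q.1 +
          ContinuousLinearMap.adjoint A (p.2 + β • (A q.1 - b))) := fun v => by
        rw [inner_add_right, ContinuousLinearMap.adjoint_inner_right, gapDeriv,
          real_inner_comm v, real_inner_comm (A v)]
      simp only [hrepr, inner_sub_left]
      exact tendsto_sub_nhds_zero_iff.2 (hx _)
    rw [add_zero] at hD
    exact le_of_tendsto_of_tendsto' hD hgap fun i => gap_add_gapDeriv_le hf hconv hβ _ _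
  · refine tendsto_nhds_unique ?_ (hmul w)
    simp only [inner_sub_left]
    exact (hl _).sub_const _

end Asymptotics

/-! ### Convergence of the solutions -/

section Convergence

variable {X Y : Type*} [NormedAddCommGroup X] [InnerProductSpace ℝ X] [CompleteSpace X]
  [NormedAddCommGroup Y] [InnerProductSpace ℝ Y] [CompleteSpace Y]
  {f : X → ℝ} {A : X →L[ℝ] Y} {b : Y} {α β θ t₀ T : ℝ}

theorem hasDerivAt_velocity {E : Type*} [NormedAddCommGroup E] [NormedSpace ℝ E] {x : ℝ → E}
    {t : ℝ} (hx : ContDiffOn ℝ 1 x (Ici t₀)) (ht : t₀ < t) :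
    HasDerivAt x (velocity t₀ x t) t :=
  ((hx.differentiableOn one_ne_zero t ht.le).hasDerivWithinAt).hasDerivAt (Ici_mem_nhds ht)

theorem contDiffOn_velocity {E : Type*} [NormedAddCommGroup E] [NormedSpace ℝ E] {x : ℝ → E}
    (hx : ContDiffOn ℝ 2 x (Ici t₀)) : ContDiffOn ℝ 1 (velocity t₀ x) (Ici t₀) :=
  hx.derivWithin (uniqueDiffOn_Ici t₀) (by norm_num)

theorem IsSolution.isFlow (hf : Differentiable ℝ f) {x₀ v₀ : X} {lam₀ w₀ : Y} {x : ℝ → X}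
    {lam : ℝ → Y} (h : IsSolution f A b α β θ t₀ x₀ v₀ lam₀ w₀ x lam) :
    IsFlow f A b α β θ t₀ x (velocity t₀ x) (acceleration t₀ x)
      lam (velocity t₀ lam) (acceleration t₀ lam) where
  hasDerivAt_primal _ ht := hasDerivAt_velocity (h.contDiffOn_primal.of_le one_le_two) ht
  hasDerivAt_primal' _ ht := hasDerivAt_velocity (contDiffOn_velocity h.contDiffOn_primal) ht
  hasDerivAt_dual _ ht := hasDerivAt_velocity (h.contDiffOn_dual.of_le one_le_two) ht
  hasDerivAt_dual' _ ht := hasDerivAt_velocity (contDiffOn_velocity h.contDiffOn_dual) ht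
  primal_eq t ht w := by
    have e := congrArg (fun v => inner ℝ v w) (h.primal_eq t ht.le)
    simp only [inner_add_left (𝕜 := ℝ) (_ + _) (gradient _ _), inner_gradient_augLagrangian hf,
      inner_zero_left] at e
    rw [inner_add_left (𝕜 := ℝ) (_ + _) (gradient _ _)]
    linarith
  dual_eq t ht := by
    have e := h.dual_eq t ht.le
    rwa [gradient_augLagrangian_dual, sub_eq_zero] at e

end Convergence

end PDAVD

theorem mainTheorem3 {X Y : Type*}
    [NormedAddCommGroup X] [InnerProductSpace ℝ X] [CompleteSpace X]
    [NormedAddCommGroup Y] [InnerProductSpace ℝ Y] [CompleteSpace Y]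
    (f : X → ℝ) (A : X →L[ℝ] Y) (b : Y)
    (hf_diff : ContDiff ℝ 1 f) (hf_conv : ConvexOn ℝ Set.univ f)
    (ℓ : ℝ≥0) (hf_lip : LipschitzWith ℓ (gradient f))
    (hS : (PDAVD.primalDualSolutions f A b).Nonempty)
    (α β θ t₀ : ℝ) (hα : 3 < α) (hβ : 0 ≤ β) (hθ₁ : 1 / (α - 1) < θ) (hθ₂ : θ < 1 / 2)
    (ht₀ : 0 < t₀)
    (x₀ v₀ : X) (lam₀ w₀ : Y) (x : ℝ → X) (lam : ℝ → Y)
    (hsol : PDAVD.IsSolution f A b α β θ t₀ x₀ v₀ lam₀ w₀ x lam) :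
    ∃ p ∈ PDAVD.primalDualSolutions f A b,
      Tendsto (fun t : ℝ => toWeakSpace ℝ (WithLp 2 (X × Y)) (WithLp.toLp 2 (x t, lam t)))
        atTop (𝓝 (toWeakSpace ℝ (WithLp 2 (X × Y)) (WithLp.toLp 2 p))) := by
  have hf : Differentiable ℝ f := hf_diff.differentiable one_ne_zero
  have hflow := hsol.isFlow hf
  have hα1 : 0 < α - 1 := by linarith
  have hθ : 0 < θ := (one_div_pos.2 hα1).trans hθ₁
  have hξ : 0 < θ * (α - 1) - 1 := sub_pos.2 ((div_lt_iff₀ hα1).1 hθ₁)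
  have hT : t₀ < t₀ + 1 := lt_add_one t₀
  have hT0 : 0 < t₀ + 1 := ht₀.trans hT
  obtain ⟨p, hp⟩ := hS
  obtain ⟨C, hC0, hC⟩ := PDAVD.exists_bound hf hf_conv hβ hθ hθ₂ hξ hp hflow hT0 hT
  -- the gap is `O(1 / t²)`, so by cocoercivity the gradients converge at the rate `O(1 / t)`
  have hgrad : ∀ t, t₀ + 1 ≤ t →
      ‖t • (gradient f (x t) - gradient f p.1)‖ ≤ √(4 * (ℓ + 1) * C) := fun t ht => by
    refine Real.le_sqrt_of_sq_le ?_
    rw [norm_smul, mul_pow, Real.norm_eq_abs, sq_abs]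
    have h1 := mul_le_mul_of_nonneg_left
      (PDAVD.norm_gradient_sub_sq_le_gap hf hf_conv hf_lip hβ hp (x t)) (sq_nonneg t)
    have h2 := mul_le_mul_of_nonneg_left (hC t ht).1 (show (0 : ℝ) ≤ 4 * (ℓ + 1) by positivity)
    linarith
  have hgap : Tendsto (fun t => PDAVD.gap f A b β p (x t)) atTop (𝓝 0) :=
    PDAVD.tendsto_zero_of_abs_sq_mul_le (K := C / (t₀ + 1)) (T := t₀ + 1) fun t ht => by
      rw [abs_of_nonneg (mul_nonneg (sq_nonneg t) (PDAVD.gap_nonneg hf hf_conv hβ hp _))]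
      exact (hC t ht).1.trans (PDAVD.le_div_mul_of_le hT0 hC0 ht)
  have hres : ∀ w, Tendsto (fun t => inner ℝ (A (x t) - b) w) atTop (𝓝 0) := fun w =>
    (PDAVD.tendsto_inner_residual hθ hθ₂ (by linarith) hflow hT0 hT hC0
      (fun t ht => (hC t ht).2.2.1) (fun t ht => (hC t ht).2.2.2.2) w).2
  have hmul : ∀ w, Tendsto (fun t => inner ℝ (lam t - p.2) (A w)) atTop (𝓝 0) :=
    PDAVD.tendsto_inner_multiplier (C := max C √(4 * (ℓ + 1) * C)) hf hf_lip.continuous hθ hθ₂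
      (by linarith) hβ hp hflow hT0 hT (hC0.trans (le_max_left _ _))
      (fun t ht => (hC t ht).2.1.trans (le_max_left _ _))
      (fun t ht => (hC t ht).2.2.2.1.trans (le_max_left _ _))
      (fun t ht => (hC t ht).2.2.1.trans (le_max_left _ _))
      (fun t ht => (hC t ht).2.2.2.2.trans (le_max_left _ _))
      (fun t ht => (hgrad t ht).trans (le_max_right _ _))
  obtain ⟨q, hq, hlim⟩ := PDAVD.exists_weak_limit_of_opial (F := atTop) (M := C + C)
    (z := fun t : ℝ => WithLp.toLp 2 (x t, lam t))
    (S := {z : WithLp 2 (X × Y) | z.ofLp ∈ PDAVD.primalDualSolutions f A b})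
    (by
      filter_upwards [eventually_ge_atTop (t₀ + 1)] with t ht
      refine le_of_sq_le_sq ?_ (by positivity)
      rw [WithLp.prod_norm_sq_eq_of_L2]
      have h1 := pow_le_pow_left₀ (norm_nonneg _) (hC t ht).2.1 2
      have h2 := pow_le_pow_left₀ (norm_nonneg _) (hC t ht).2.2.1 2
      change ‖x t‖ ^ 2 + ‖lam t‖ ^ 2 ≤ (C + C) ^ 2
      linarith [mul_nonneg hC0 hC0])
    (fun z hz => by
      obtain ⟨l, hl⟩ := PDAVD.exists_tendsto_anchor hf hf_conv hβ (by linarith) hθ hθ₂ hξ hz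
        hflow hT0 hT
      refine ⟨2 * l, (hl.const_mul 2).congr fun t => ?_⟩
      rw [WithLp.prod_norm_sq_eq_of_L2, PDAVD.anchor]
      simp)
    (fun U hU z hz => by
      refine PDAVD.mem_primalDualSolutions_of_weak_limit hf hf_conv hβ hp (hgap.mono_left hU)
        (fun w => (hres w).mono_left hU) (fun w => (hmul w).mono_left hU) (fun w => ?_)
        fun w => ?_
      · simpa [WithLp.prod_inner_apply] using hz (WithLp.toLp 2 (w, 0))
      · simpa [WithLp.prod_inner_apply] using hz (WithLp.toLp 2 (0, w)))
  exact ⟨q.ofLp, hq, PDAVD.tendsto_toWeakSpace_iff.2 hlim⟩
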